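/- Let $\mathsf{Func}_{n,m}$ be the set of functions $H:\{0,1\}^n\to\{0,1\}^m$. A quantum algorithm making $Q$ quantum queries to $H$ encodes its classical input as a computational basis state, applies oracle-independent unitaries interleaved with $Q$ applications of $|x\rangle|y\rangle\mapsto|x\rangle|y\oplus H(x)\rangle$ (with any number of work qubits), measures the final state in the computational basis and computes its classical output from the measurement outcome. Such an algorithm is $\delta$-deterministic if for every oracle $H\in\mathsf{Func}_{n,m}$ and every input $x$ there is a value $y$ (which may depend on $H$ and $x$) such that the output differs from $y$ with probability at most $\delta$. A classical-query algorithm is a computationally unbounded randomized algorithm that queries $H$ at points $x\in\{0,1\}^n$; its number of queries is counted in the worst case. For a quantum-query algorithm $G:\{0,1\}^k\to\{0,1\}^\ell$ and a (quantum- or classical-query) distinguisher $\mathcal D$ with one-bit output, both having access to $H$, let $$\mathsf{Adv}^{\mathsf{PRG}}_{\mathcal D,G}=\left|\Pr_{H\leftarrow \mathsf{Func}_{n,m},\ s\leftarrow\{0,1\}^k}\left[\mathcal D^{H}(G^{|H\rangle}(s))=1\right]-\Pr_{H\leftarrow \mathsf{Func}_{n,m},\ g\leftarrow\{0,1\}^\ell}\left[\mathcal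 D^{H}(g)=1\right]\right|.$$ There is a polynomial $P$ in six variables with nonnegative integer coefficients such that the following holds for all $n,m,k,\ell,Q_G,Q_{\mathcal A}\in\mathbb N$ and all real $\delta<1/2$. Let $G:\{0,1\}^k\to\{0,1\}^\ell$ be a $\delta$-deterministic algorithm making $Q_G$ quantum queries to a random oracle $H:\{0,1\}^n\to\{0,1\}^m$, and let $\mathcal A$ be a distinguisher making $Q_{\mathcal A}$ quantum queries to the same oracle, with advantage $\epsilon=\mathsf{Adv}^{\mathsf{PRG}}_{\mathcal A,G}>0$. Then there is a classical-query distinguisher $\mathcal B$ making at most $P\left(k,n,Q_{\mathcal A},Q_G,\epsilon^{-1},(1-2\delta)^{-1}\right)$ classical queries to $H$ such that $$\mathsf{Adv}^{\mathsf{PRG}}_{\mathcal B,G}\ge\frac{\epsilon}{2}-\delta .$$ In particular, for $\delta$ bounded away from $1/2$ by a constant, $\mathcal B$ makes $\mathrm{poly}(k,n,Q_{\mathcal A},Q_G,\epsilon^{-1})$ queries. -/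

import Mathlib

open scoped BigOperators

noncomputable section

/-- The set `{0,1}^n`. -/
abbrev Bits (n : ℕ) : Type := Fin n → Bool

/-- Bitwise exclusive or. -/
def Bits.xor {m : ℕ} (y z : Bits m) : Bits m := fun j => Bool.xor (y j) (z j)

/-- `Func_{n,m}`, the set of all oracles `{0,1}^n → {0,1}^m`. -/
abbrev Oracle (n m : ℕ) : Type := Bits n → Bits m

/-- Computational basis of the state space of an oracle algorithm: a query register of `n` qubits,
an answer register of `m` qubits and a work register of `w` qubits. -/
abbrev QBasis (n m w : ℕ) : Type := Bits n × Bits m × Bits w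

/-- The unitary `|x⟩|y⟩|z⟩ ↦ |x⟩|y ⊕ H(x)⟩|z⟩`, as a matrix. -/
def oracleUnitary {n m : ℕ} (w : ℕ) (H : Oracle n m) :
    Matrix (QBasis n m w) (QBasis n m w) ℂ :=
  fun b' b => if b' = (b.1, Bits.xor b.2.1 (H b.1), b.2.2) then 1 else 0

/-- A quantum algorithm with classical inputs in `α` and classical outputs in `β` that makes `Q`
quantum queries to an oracle `{0,1}^n → {0,1}^m`. The input `a` is encoded as the basis state
`|enc a⟩`; oracle-independent unitaries are interleaved with the oracle calls; the final state is
measured in the computational basis and the output is read off the measurement outcome by `dec`. -/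
structure QuantumAlg (n m Q : ℕ) (α β : Type) where
  /-- number of work qubits -/
  w : ℕ
  /-- encoding of the classical input -/
  enc : α → QBasis n m w
  /-- `U 0` is applied before the first query, `U i` right after query `i`;
  only `U 0, …, U Q` are ever used -/
  U : ℕ → Matrix.unitaryGroup (QBasis n m w) ℂ
  /-- output as a function of the measurement outcome -/
  dec : QBasis n m w → β

namespace QuantumAlg

variable {n m Q : ℕ} {α β : Type}

/-- The (unmeasured) state after the first `i` queries on oracle `H` and input `a`. -/
def state (A : QuantumAlg n m Q α β) (H : Oracle n m) (a : α) :
    ℕ → QBasis n m A.w → ℂ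
  | 0 => (A.U 0 : Matrix (QBasis n m A.w) (QBasis n m A.w) ℂ).mulVec (Pi.single (A.enc a) 1)
  | i + 1 => (A.U (i + 1) : Matrix (QBasis n m A.w) (QBasis n m A.w) ℂ).mulVec
      ((oracleUnitary A.w H).mulVec (state A H a i))

/-- The probability that the algorithm, given quantum access to `H`, outputs `b` on input `a`. -/
def prob [DecidableEq β] (A : QuantumAlg n m Q α β) (H : Oracle n m) (a : α) (b : β) : ℝ :=
  ∑ z : QBasis n m A.w, if A.dec z = b then ‖A.state H a Q z‖ ^ 2 else 0

/-- For every oracle and every input there is a value (which may depend on both) such that the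
probability of outputting anything else is at most `δ`. -/
def IsDeterministic [Fintype β] [DecidableEq β] (A : QuantumAlg n m Q α β) (δ : ℝ) : Prop :=
  ∀ (H : Oracle n m) (a : α), ∃ y : β, ∑ b ∈ Finset.univ.filter (· ≠ y), A.prob H a b ≤ δ

end QuantumAlg

/-- A run of a computationally unbounded randomized algorithm with classical access to an oracle
`{0,1}^n → {0,1}^m`, as a randomized decision tree: output a value, query the oracle at a point and
continue depending on the answer, or continue with `t₁` with probability `p` and with `t₂`
otherwise. -/
inductive ClassicalTree (n m : ℕ) (β : Type) : Type where
  | output (b : β) : ClassicalTree n m β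
  | query (x : Bits n) (next : Bits m → ClassicalTree n m β) : ClassicalTree n m β
  | toss (p : unitInterval) (t₁ t₂ : ClassicalTree n m β) : ClassicalTree n m β

namespace ClassicalTree

variable {n m : ℕ} {β : Type}

/-- The largest number of oracle queries on any path (over all answers and coin tosses). -/
def queries : ClassicalTree n m β → ℕ
  | output _ => 0
  | query _ next => 1 + Finset.univ.sup (fun y => (next y).queries)
  | toss _ t₁ t₂ => max t₁.queries t₂.queries

/-- The probability of output `b` when the queries are answered by `H`. -/
def prob [DecidableEq β] (H : Oracle n m) (b : β) : ClassicalTree n m β → ℝ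
  | output b' => if b' = b then 1 else 0
  | query x next => prob H b (next (H x))
  | toss p t₁ t₂ => (p : ℝ) * prob H b t₁ + (1 - (p : ℝ)) * prob H b t₂

end ClassicalTree

/-- A classical-query algorithm: for every input, a randomized decision tree. -/
abbrev ClassicalAlg (n m : ℕ) (α β : Type) : Type := α → ClassicalTree n m β

/-- The distinguishing advantage relative to `G` of a distinguisher that, on input `g` and with
access to `H`, outputs `1` with probability `D H g`:
`|Pr_{H, s, g ← G^{|H⟩}(s)}[D^H(g) = 1] - Pr_{H, g}[D^H(g) = 1]|`, with `H`, `s`, and in the second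
experiment `g`, uniform. -/
def prgAdvantage {n m k l Q : ℕ} (G : QuantumAlg n m Q (Bits k) (Bits l))
    (D : Oracle n m → Bits l → ℝ) : ℝ :=
  |(𝔼 H : Oracle n m, 𝔼 s : Bits k, ∑ g : Bits l, G.prob H s g * D H g)
    - (𝔼 H : Oracle n m, 𝔼 g : Bits l, D H g)|

/-- Advantage of a quantum-query distinguisher. -/
def quantumAdvantage {n m k l QG QA : ℕ} (A : QuantumAlg n m QA (Bits l) Bool)
    (G : QuantumAlg n m QG (Bits k) (Bits l)) : ℝ :=
  prgAdvantage G (fun H g => A.prob H g true)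

/-- Advantage of a classical-query distinguisher. -/
def classicalAdvantage {n m k l QG : ℕ} (B : ClassicalAlg n m (Bits l) Bool)
    (G : QuantumAlg n m QG (Bits k) (Bits l)) : ℝ :=
  prgAdvantage G (fun H g => (B g).prob H true)

end

/-!
The classical distinguisher learns, for its input `g`, all points that the quantum distinguisher `A`
on input `g` queries with noticeable weight on average over the oracles consistent with the answers
so far (`learnHeavy`). It then accepts with the average, over the consistent oracles, of the
acceptance probability of `A`.

If `g` is uniform and independent of the oracle, this reproduces the acceptance probability of `A`
exactly, by the tower law (`cubeAvg_prob_learnHeavy`), even if the learning is cut off.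

If `g` is an output of the generator `G`, the oracle is correlated with `g`, but only through few
points. A function computed by few quantum queries with error below `1 / 2` has small block
sensitivity by the hybrid argument (`QuantumAlg.blockSensitivityLE`), hence small certificates, and
it is constant on the parts of a partition of the set of oracles into subcubes with few fixed points
(`BlockSensitivityLE.abs_expect_comp_le`). So it suffices to compare the two distinguishers on an
oracle that is uniform except for a planted set `C` of few fixed values. After the learning no point
is heavy for an oracle without the plant, and by the hybrid argument planting `C` changes the
acceptance probability of `A` by little (`QueryBounded.abs_cubeAvg_union_sub_le`). The learning
rarely needs many queries, with the plant too: until it queries a point of `C` the answers are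
distributed as without the plant, each query of a heavy point is expected to use up some of the
total query weight of `A`, and only the few queries in `C` can start this count anew
(`abs_cubeAvg_union_learnHeavy_sub_le`).

None of the bounds depends on the input, output or seed lengths.
-/

/-! ### The Euclidean norm on amplitude vectors -/

/-- The Euclidean norm of a vector of amplitudes; plain functions carry the sup norm. -/
noncomputable def ampNorm {ι : Type*} [Fintype ι] (v : ι → ℂ) : ℝ :=
  ‖(WithLp.toLp 2 v : EuclideanSpace ℂ ι)‖

/-- Restriction of a vector of amplitudes to the basis states in `T`. -/
noncomputable def ampRestrict {ι : Type*} (T : Set ι) (v : ι → ℂ) : ι → ℂ := T.indicator v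

lemma ampRestrict_sub {ι : Type*} (T : Set ι) (v w : ι → ℂ) :
    ampRestrict T (v - w) = ampRestrict T v - ampRestrict T w :=
  Set.indicator_sub' T v w

section AmpNorm

variable {ι : Type*} [Fintype ι]

lemma ampNorm_nonneg (v : ι → ℂ) : 0 ≤ ampNorm v := norm_nonneg _

lemma ampNorm_sq (v : ι → ℂ) : ampNorm v ^ 2 = ∑ z, ‖v z‖ ^ 2 := by
  simp [ampNorm, EuclideanSpace.norm_sq_eq]

lemma ampNorm_add_le (v w : ι → ℂ) : ampNorm (v + w) ≤ ampNorm v + ampNorm w := by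
  simpa [ampNorm] using norm_add_le (WithLp.toLp 2 v : EuclideanSpace ℂ ι) (WithLp.toLp 2 w)

lemma ampNorm_sub_le (v w : ι → ℂ) : ampNorm (v - w) ≤ ampNorm v + ampNorm w := by
  simpa [ampNorm] using norm_sub_le (WithLp.toLp 2 v : EuclideanSpace ℂ ι) (WithLp.toLp 2 w)

lemma abs_ampNorm_sub_le (v w : ι → ℂ) : |ampNorm v - ampNorm w| ≤ ampNorm (v - w) := by
  simpa [ampNorm] using
    abs_norm_sub_norm_le (WithLp.toLp 2 v : EuclideanSpace ℂ ι) (WithLp.toLp 2 w)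

lemma ampNorm_le_of_sq_le {v w : ι → ℂ} (h : ∑ z, ‖v z‖ ^ 2 ≤ ∑ z, ‖w z‖ ^ 2) :
    ampNorm v ≤ ampNorm w := by
  rw [← ampNorm_sq, ← ampNorm_sq] at h
  exact le_of_sq_le_sq h (ampNorm_nonneg w)

lemma ampNorm_comp_equiv (e : ι ≃ ι) (v : ι → ℂ) : ampNorm (v ∘ e) = ampNorm v := by
  have h : ∑ z, ‖(v ∘ e) z‖ ^ 2 = ∑ z, ‖v z‖ ^ 2 := e.sum_comp (fun z => ‖v z‖ ^ 2)
  exact le_antisymm (ampNorm_le_of_sq_le h.le) (ampNorm_le_of_sq_le h.ge)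

lemma ampNorm_unitary_mulVec [DecidableEq ι] (U : Matrix.unitaryGroup ι ℂ) (v : ι → ℂ) :
    ampNorm ((U : Matrix ι ι ℂ).mulVec v) = ampNorm v := by
  have key : ∀ w : ι → ℂ, ((∑ z, ‖w z‖ ^ 2 : ℝ) : ℂ) = star w ⬝ᵥ w := by
    intro w
    simp only [dotProduct, Pi.star_apply, RCLike.star_def, Complex.conj_mul']
    push_cast
    rfl
  have h : ((∑ z, ‖(U : Matrix ι ι ℂ).mulVec v z‖ ^ 2 : ℝ) : ℂ) = (∑ z, ‖v z‖ ^ 2 : ℝ) := by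
    rw [key, key, Matrix.star_mulVec, Matrix.dotProduct_mulVec, Matrix.vecMul_vecMul,
      ← Matrix.star_eq_conjTranspose, Unitary.coe_star_mul_self, Matrix.vecMul_one]
  have h' := Complex.ofReal_injective h
  exact le_antisymm (ampNorm_le_of_sq_le h'.le) (ampNorm_le_of_sq_le h'.ge)


lemma ampNorm_ampRestrict_sq (T : Set ι) [DecidablePred (· ∈ T)] (v : ι → ℂ) :
    ampNorm (ampRestrict T v) ^ 2 = ∑ z, if z ∈ T then ‖v z‖ ^ 2 else 0 := by
  rw [ampNorm_sq]
  refine Finset.sum_congr rfl fun z _ => ?_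
  by_cases h : z ∈ T <;> simp [ampRestrict, h]

lemma ampNorm_ampRestrict_le (T : Set ι) (v : ι → ℂ) : ampNorm (ampRestrict T v) ≤ ampNorm v := by
  refine ampNorm_le_of_sq_le (Finset.sum_le_sum fun z _ => ?_)
  by_cases h : z ∈ T <;> simp [ampRestrict, h]

end AmpNorm

/-! ### Quantum query weights and the hybrid argument -/

lemma Bits.xor_xor_cancel {m : ℕ} (y z : Bits m) : (y.xor z).xor z = y := by
  funext j
  simp [Bits.xor]

/-- The permutation of the computational basis that the oracle unitary realizes. -/
def oraclePerm {n m : ℕ} (w : ℕ) (H : Oracle n m) : QBasis n m w ≃ QBasis n m w where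
  toFun b := (b.1, b.2.1.xor (H b.1), b.2.2)
  invFun b := (b.1, b.2.1.xor (H b.1), b.2.2)
  left_inv b := by simp [Bits.xor_xor_cancel]
  right_inv b := by simp [Bits.xor_xor_cancel]

lemma oracleUnitary_mulVec {n m : ℕ} (w : ℕ) (H : Oracle n m) (v : QBasis n m w → ℂ) :
    (oracleUnitary w H).mulVec v = v ∘ oraclePerm w H := by
  funext b
  have h : ∀ c : QBasis n m w,
      (b = (c.1, Bits.xor c.2.1 (H c.1), c.2.2)) ↔ c = oraclePerm w H b := by
    intro c
    rw [← Equiv.symm_apply_eq]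
    exact eq_comm
  simp only [Matrix.mulVec, dotProduct, oracleUnitary, h, ite_mul, one_mul, zero_mul,
    Finset.sum_ite_eq', Finset.mem_univ, if_true, Function.comp_apply]

/-- Two oracle calls act alike on the part of the state that does not query `X`, when the oracles
agree off `X`. -/
lemma ampNorm_oracleUnitary_sub_le {n m : ℕ} (w : ℕ) {H₁ H₂ : Oracle n m} {X : Finset (Bits n)}
    (h : ∀ x ∉ X, H₁ x = H₂ x) (v : QBasis n m w → ℂ) :
    ampNorm ((oracleUnitary w H₁).mulVec v - (oracleUnitary w H₂).mulVec v) ≤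
      2 * ampNorm (ampRestrict {z : QBasis n m w | z.1 ∈ X} v) := by
  set T : Set (QBasis n m w) := {z | z.1 ∈ X} with hT
  have e : (oracleUnitary w H₁).mulVec v - (oracleUnitary w H₂).mulVec v =
      ampRestrict T v ∘ oraclePerm w H₁ - ampRestrict T v ∘ oraclePerm w H₂ := by
    rw [oracleUnitary_mulVec, oracleUnitary_mulVec]
    funext z
    by_cases hz : z.1 ∈ X
    · simp [ampRestrict, hT, oraclePerm, hz]
    · simp [ampRestrict, hT, oraclePerm, hz, h _ hz]
  rw [e]
  refine (ampNorm_sub_le _ _).trans ?_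
  rw [ampNorm_comp_equiv, ampNorm_comp_equiv, two_mul]

namespace QuantumAlg

variable {n m Q : ℕ} {α β : Type}

lemma ampNorm_state (A : QuantumAlg n m Q α β) (H : Oracle n m) (a : α) (i : ℕ) :
    ampNorm (A.state H a i) = 1 := by
  induction i with
  | zero =>
    rw [state, ampNorm_unitary_mulVec, ← sq_eq_sq₀ (ampNorm_nonneg _) zero_le_one, ampNorm_sq]
    simp [Pi.single_apply, apply_ite norm, ite_pow]
  | succ i ih =>
    rw [state, ampNorm_unitary_mulVec, oracleUnitary_mulVec, ampNorm_comp_equiv, ih]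

/-- The total weight with which `A` queries its oracle `H` at the point `x`: the sum over the
queries of the squared norm of the part of the state that asks for `x`. -/
noncomputable def queryWeight (A : QuantumAlg n m Q α β) (a : α) (x : Bits n)
    (H : Oracle n m) : ℝ :=
  ∑ t ∈ Finset.range Q, ∑ z : QBasis n m A.w, if z.1 = x then ‖A.state H a t z‖ ^ 2 else 0

lemma queryWeight_nonneg (A : QuantumAlg n m Q α β) (a : α) (x : Bits n) (H : Oracle n m) :
    0 ≤ A.queryWeight a x H :=
  Finset.sum_nonneg fun _ _ => Finset.sum_nonneg fun _ _ => by positivity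

lemma sum_queryWeight_eq (A : QuantumAlg n m Q α β) (a : α) (X : Finset (Bits n))
    (H : Oracle n m) :
    ∑ x ∈ X, A.queryWeight a x H =
      ∑ t ∈ Finset.range Q, ampNorm (ampRestrict {z | z.1 ∈ X} (A.state H a t)) ^ 2 := by
  unfold queryWeight
  rw [Finset.sum_comm]
  refine Finset.sum_congr rfl fun t _ => ?_
  rw [Finset.sum_comm, ampNorm_ampRestrict_sq]
  refine Finset.sum_congr rfl fun z _ => ?_
  simp

lemma sum_univ_queryWeight (A : QuantumAlg n m Q α β) (a : α) (H : Oracle n m) :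
    ∑ x, A.queryWeight a x H = Q := by
  rw [sum_queryWeight_eq]
  have h : ∀ t, ampNorm (ampRestrict {z | z.1 ∈ Finset.univ} (A.state H a t)) = 1 := by
    intro t
    rw [← A.ampNorm_state H a t]
    simp [ampRestrict]
  simp only [h, one_pow, Finset.sum_const, Finset.card_range, nsmul_eq_mul, mul_one]

/-- The hybrid argument: replacing the oracle calls one at a time. -/
lemma ampNorm_state_sub_le (A : QuantumAlg n m Q α β) (a : α) {H₁ H₂ : Oracle n m}
    {X : Finset (Bits n)} (h : ∀ x ∉ X, H₁ x = H₂ x) (i : ℕ) :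
    ampNorm (A.state H₁ a i - A.state H₂ a i) ≤
      ∑ t ∈ Finset.range i, 2 * ampNorm (ampRestrict {z | z.1 ∈ X} (A.state H₁ a t)) := by
  induction i with
  | zero =>
    rw [← sq_le_sq₀ (ampNorm_nonneg _) (by simp), ampNorm_sq]
    simp [state]
  | succ i ih =>
    rw [state, state, ← Matrix.mulVec_sub, ampNorm_unitary_mulVec, Finset.sum_range_succ]
    have e : (oracleUnitary A.w H₁).mulVec (A.state H₁ a i) -
        (oracleUnitary A.w H₂).mulVec (A.state H₂ a i) =
        (A.state H₁ a i - A.state H₂ a i) ∘ oraclePerm A.w H₂ +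
        ((oracleUnitary A.w H₁).mulVec (A.state H₁ a i) -
          (oracleUnitary A.w H₂).mulVec (A.state H₁ a i)) := by
      simp only [oracleUnitary_mulVec]
      funext z
      simp
    rw [e]
    refine (ampNorm_add_le _ _).trans (add_le_add ?_ (ampNorm_oracleUnitary_sub_le _ h _))
    rw [ampNorm_comp_equiv]
    exact ih

variable [DecidableEq β]

lemma prob_eq_ampNorm_sq (A : QuantumAlg n m Q α β) (H : Oracle n m) (a : α) (b : β) :
    A.prob H a b = ampNorm (ampRestrict {z | A.dec z = b} (A.state H a Q)) ^ 2 := by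
  rw [ampNorm_ampRestrict_sq]
  rfl

lemma prob_nonneg (A : QuantumAlg n m Q α β) (H : Oracle n m) (a : α) (b : β) :
    0 ≤ A.prob H a b := by
  rw [prob_eq_ampNorm_sq]
  positivity

lemma prob_le_one (A : QuantumAlg n m Q α β) (H : Oracle n m) (a : α) (b : β) :
    A.prob H a b ≤ 1 := by
  rw [prob_eq_ampNorm_sq]
  exact pow_le_one₀ (ampNorm_nonneg _)
    ((ampNorm_ampRestrict_le _ _).trans (A.ampNorm_state H a Q).le)

lemma sum_prob [Fintype β] (A : QuantumAlg n m Q α β) (H : Oracle n m) (a : α) :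
    ∑ b, A.prob H a b = 1 := by
  unfold prob
  rw [Finset.sum_comm]
  have h := ampNorm_sq (A.state H a Q)
  rw [ampNorm_state, one_pow] at h
  simp [← h]

/-- Changing the oracle at points of small query weight hardly changes the output probabilities. -/
lemma sq_prob_sub_le (A : QuantumAlg n m Q α β) (a : α) (b : β) {H₁ H₂ : Oracle n m}
    {X : Finset (Bits n)} (h : ∀ x ∉ X, H₁ x = H₂ x) :
    (A.prob H₁ a b - A.prob H₂ a b) ^ 2 ≤ 16 * Q * ∑ x ∈ X, A.queryWeight a x H₁ := by
  set T : Set (QBasis n m A.w) := {z | A.dec z = b}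
  set u₁ := ampNorm (ampRestrict T (A.state H₁ a Q))
  set u₂ := ampNorm (ampRestrict T (A.state H₂ a Q))
  have h1 : u₁ ≤ 1 := (ampNorm_ampRestrict_le _ _).trans (A.ampNorm_state _ _ _).le
  have h2 : u₂ ≤ 1 := (ampNorm_ampRestrict_le _ _).trans (A.ampNorm_state _ _ _).le
  have h1' : 0 ≤ u₁ := ampNorm_nonneg _
  have h2' : 0 ≤ u₂ := ampNorm_nonneg _
  set s := ∑ t ∈ Finset.range Q, ampNorm (ampRestrict {z | z.1 ∈ X} (A.state H₁ a t)) with hs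
  have hd : |u₁ - u₂| ≤ 2 * s := by
    refine (abs_ampNorm_sub_le _ _).trans ?_
    rw [← ampRestrict_sub, hs, Finset.mul_sum]
    exact (ampNorm_ampRestrict_le _ _).trans (A.ampNorm_state_sub_le a h Q)
  have hcs : s ^ 2 ≤ Q * ∑ x ∈ X, A.queryWeight a x H₁ := by
    rw [sum_queryWeight_eq]
    simpa using sq_sum_le_card_mul_sum_sq (s := Finset.range Q)
      (f := fun t => ampNorm (ampRestrict {z | z.1 ∈ X} (A.state H₁ a t)))
  have hd2 : (u₁ - u₂) ^ 2 ≤ (2 * s) ^ 2 := by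
    rw [← sq_abs]
    exact pow_le_pow_left₀ (abs_nonneg _) hd 2
  have hs2 : (u₁ + u₂) ^ 2 ≤ 4 := by nlinarith
  rw [prob_eq_ampNorm_sq, prob_eq_ampNorm_sq]
  calc (u₁ ^ 2 - u₂ ^ 2) ^ 2 = (u₁ - u₂) ^ 2 * (u₁ + u₂) ^ 2 := by ring
    _ ≤ (2 * s) ^ 2 * 4 := mul_le_mul hd2 hs2 (sq_nonneg _) (sq_nonneg _)
    _ = 16 * s ^ 2 := by ring
    _ ≤ 16 * (Q * ∑ x ∈ X, A.queryWeight a x H₁) := by linarith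
    _ = _ := by ring

end QuantumAlg

/-! ### Functions controlled by query weights -/

section QueryBounded

variable {ι κ : Type*} [Fintype ι]

/-- `p` behaves like the acceptance probability of an algorithm whose total query weight is at most
`Q`: on the oracle `H` the point `x` is queried with weight `W x H`, and changing `H` at points of
small weight hardly changes `p`. -/
structure QueryBounded (Q : ℝ) (W : ι → (ι → κ) → ℝ) (p : (ι → κ) → ℝ) : Prop where
  weight_nonneg : ∀ x H, 0 ≤ W x H
  sum_weight_le : ∀ H, ∑ x, W x H ≤ Q
  nonneg : ∀ H, 0 ≤ p H
  le_one : ∀ H, p H ≤ 1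
  sq_sub_le : ∀ (H₁ H₂ : ι → κ) (X : Finset ι), (∀ x ∉ X, H₁ x = H₂ x) →
    (p H₁ - p H₂) ^ 2 ≤ 16 * Q * ∑ x ∈ X, W x H₁

namespace QueryBounded

variable {Q : ℝ} {W : ι → (ι → κ) → ℝ} {p : (ι → κ) → ℝ}

lemma sum_le (h : QueryBounded Q W p) (X : Finset ι) (H : ι → κ) : ∑ x ∈ X, W x H ≤ Q :=
  (Finset.sum_le_sum_of_subset_of_nonneg X.subset_univ
    fun x _ _ => h.weight_nonneg x H).trans (h.sum_weight_le H)

lemma bound_nonneg [Nonempty κ] (h : QueryBounded Q W p) : 0 ≤ Q := by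
  have := h.sum_le ∅ (fun _ => Classical.arbitrary κ)
  simpa using this

end QueryBounded

end QueryBounded

/-! ### Averages over subcubes of the set of oracles -/

section CubeAvg

variable {ι κ : Type*} [Fintype ι] [DecidableEq ι] [Fintype κ]

/-- The average of `f` over the subcube of all functions that agree with `K` on `S`, computed by
overwriting a uniform function with `K` on `S`. -/
noncomputable def cubeAvg (S : Finset ι) (K : ι → κ) (f : (ι → κ) → ℝ) : ℝ :=
  𝔼 H : ι → κ, f (S.piecewise K H)

lemma cubeAvg_empty (K : ι → κ) (f : (ι → κ) → ℝ) : cubeAvg ∅ K f = 𝔼 H, f H := by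
  simp [cubeAvg]

lemma cubeAvg_mono {S : Finset ι} {K : ι → κ} {f g : (ι → κ) → ℝ}
    (h : ∀ H, (∀ x ∈ S, H x = K x) → f H ≤ g H) : cubeAvg S K f ≤ cubeAvg S K g :=
  Finset.expect_le_expect fun _ _ => h _ fun _ hx => Finset.piecewise_eq_of_mem _ _ _ hx

lemma cubeAvg_congr {S : Finset ι} {K : ι → κ} {f g : (ι → κ) → ℝ}
    (h : ∀ H, (∀ x ∈ S, H x = K x) → f H = g H) : cubeAvg S K f = cubeAvg S K g :=
  le_antisymm (cubeAvg_mono fun H hH => (h H hH).le) (cubeAvg_mono fun H hH => (h H hH).ge)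

lemma cubeAvg_sub (S : Finset ι) (K : ι → κ) (f g : (ι → κ) → ℝ) :
    cubeAvg S K (fun H => f H - g H) = cubeAvg S K f - cubeAvg S K g :=
  Finset.expect_sub_distrib _ _ _

lemma cubeAvg_const_mul (S : Finset ι) (K : ι → κ) (c : ℝ) (f : (ι → κ) → ℝ) :
    cubeAvg S K (fun H => c * f H) = c * cubeAvg S K f :=
  (Finset.mul_expect _ _ _).symm

lemma cubeAvg_sum {α : Type*} (S : Finset ι) (K : ι → κ) (T : Finset α)
    (f : α → (ι → κ) → ℝ) :
    cubeAvg S K (fun H => ∑ a ∈ T, f a H) = ∑ a ∈ T, cubeAvg S K (f a) :=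
  Finset.expect_sum_comm _ _ _

lemma cubeAvg_nonneg {S : Finset ι} {K : ι → κ} {f : (ι → κ) → ℝ} (h : ∀ H, 0 ≤ f H) :
    0 ≤ cubeAvg S K f :=
  Finset.expect_nonneg fun _ _ => h _

lemma abs_cubeAvg_le (S : Finset ι) (K : ι → κ) (f : (ι → κ) → ℝ) :
    |cubeAvg S K f| ≤ cubeAvg S K (fun H => |f H|) :=
  Finset.abs_expect_le _ _

/-- Tower law: a uniform element of a subcube is obtained by first fixing its values on a larger
set of points and then drawing from the smaller subcube so determined. -/
lemma cubeAvg_tower {S S' : Finset ι} (h : S ⊆ S') (K : ι → κ) (f : (ι → κ) → ℝ) :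
    cubeAvg S K f = cubeAvg S K (fun H => cubeAvg S' H f) := by
  -- exchanging the values of two functions off `S'` is an involution on pairs
  let e : ((ι → κ) × (ι → κ)) ≃ ((ι → κ) × (ι → κ)) :=
    { toFun := fun q => (S'.piecewise q.1 q.2, S'.piecewise q.2 q.1)
      invFun := fun q => (S'.piecewise q.1 q.2, S'.piecewise q.2 q.1)
      left_inv := fun q => by
        ext x <;> by_cases hx : x ∈ S' <;> simp [hx]
      right_inv := fun q => by
        ext x <;> by_cases hx : x ∈ S' <;> simp [hx] }
  unfold cubeAvg
  by_cases hne : Nonempty (ι → κ)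
  · calc 𝔼 H, f (S.piecewise K H)
        = 𝔼 H : ι → κ, 𝔼 _H' : ι → κ, f (S.piecewise K H) := by
          simp_rw [Fintype.expect_const]
      _ = 𝔼 q : (ι → κ) × (ι → κ), f (S.piecewise K q.1) := by
          rw [← Finset.univ_product_univ, Finset.expect_product]
      _ = 𝔼 q : (ι → κ) × (ι → κ), f (S'.piecewise (S.piecewise K q.1) q.2) := by
          refine (Fintype.expect_equiv e _ _ fun q => ?_).symm
          congr 1
          funext x
          by_cases hx : x ∈ S
          · simp [e, hx, h hx]
          · by_cases hx' : x ∈ S' <;> simp [e, hx, hx']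
      _ = _ := by rw [← Finset.univ_product_univ, Finset.expect_product]
  · rw [not_nonempty_iff] at hne
    simp

lemma cubeAvg_insert {S : Finset ι} {x : ι} (hx : x ∉ S) (K : ι → κ) (f : (ι → κ) → ℝ) :
    cubeAvg S K f =
      𝔼 H : ι → κ, cubeAvg (insert x S) (Function.update K x (H x)) f := by
  rw [cubeAvg_tower (Finset.subset_insert x S)]
  refine Finset.expect_congr rfl fun H _ => ?_
  refine Finset.expect_congr rfl fun H' _ => ?_
  congr 1
  refine Finset.piecewise_congr _ (fun z hz => ?_) fun _ _ => rfl
  rcases Finset.mem_insert.1 hz with rfl | hz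
  · simp [hx]
  · have : z ≠ x := fun h => hx (h ▸ hz)
    simp [hz, this]

lemma cubeAvg_union (S C : Finset ι) (K : ι → κ) (f : (ι → κ) → ℝ) :
    cubeAvg (S ∪ C) K f = cubeAvg S K (fun H => f (C.piecewise K H)) := by
  refine Finset.expect_congr rfl fun H _ => ?_
  congr 1
  funext x
  by_cases hx : x ∈ C <;> by_cases hx' : x ∈ S <;> simp [hx, hx']

variable [Nonempty κ]

lemma cubeAvg_const (S : Finset ι) (K : ι → κ) (c : ℝ) : cubeAvg S K (fun _ => c) = c :=
  Fintype.expect_const c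

lemma sq_cubeAvg_le (S : Finset ι) (K : ι → κ) (f : (ι → κ) → ℝ) :
    cubeAvg S K f ^ 2 ≤ cubeAvg S K (fun H => f H ^ 2) := by
  simpa [cubeAvg] using Finset.expect_mul_sq_le_sq_mul_sq Finset.univ
    (fun H : ι → κ => f (S.piecewise K H)) (fun _ => 1)

namespace QueryBounded

variable {Q : ℝ} {W : ι → (ι → κ) → ℝ} {p : (ι → κ) → ℝ}

/-- If no point outside `S` is heavy on average over a subcube with fixed points `S`, then fixing
the values at the few further points of `C` hardly changes the average of `p`. -/
lemma abs_cubeAvg_union_sub_le (h : QueryBounded Q W p) {τ : ℝ} (hτ : 0 ≤ τ)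
    {S C : Finset ι} {K : ι → κ} (hS : ∀ x ∉ S, cubeAvg S K (W x) ≤ τ) :
    |cubeAvg (S ∪ C) K p - cubeAvg S K p| ≤ 4 * √(Q * C.card * τ) := by
  have hQ := h.bound_nonneg
  refine abs_le_of_sq_le_sq ?_ (by positivity)
  rw [mul_pow, Real.sq_sqrt (by positivity), cubeAvg_union, ← cubeAvg_sub]
  calc _ ≤ cubeAvg S K (fun H => (p (C.piecewise K H) - p H) ^ 2) := sq_cubeAvg_le _ _ _
    _ ≤ cubeAvg S K (fun H => 16 * Q * ∑ x ∈ C \ S, W x H) := by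
      refine cubeAvg_mono fun H hH => ?_
      rw [← neg_sub, neg_sq]
      refine h.sq_sub_le _ _ _ fun x hx => ?_
      by_cases hxC : x ∈ C
      · have hxS : x ∈ S := by simpa [hxC] using hx
        simp [hxC, hH x hxS]
      · simp [hxC]
    _ = 16 * Q * ∑ x ∈ C \ S, cubeAvg S K (W x) := by
      rw [cubeAvg_const_mul, cubeAvg_sum]
    _ ≤ 16 * Q * (C.card * τ) := by
      refine mul_le_mul_of_nonneg_left ?_ (by positivity)
      calc ∑ x ∈ C \ S, cubeAvg S K (W x) ≤ ∑ x ∈ C \ S, τ :=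
            Finset.sum_le_sum fun x hx => hS x (Finset.mem_sdiff.1 hx).2
        _ = (C \ S).card * τ := by simp
        _ ≤ C.card * τ := by
          gcongr
          exact Finset.sdiff_subset
    _ = _ := by ring

end QueryBounded

end CubeAvg

/-! ### Learning the heavy points classically -/

lemma ClassicalTree.prob_mem_Icc {n m : ℕ} {β : Type} [DecidableEq β] (H : Oracle n m) (b : β)
    (t : ClassicalTree n m β) : t.prob H b ∈ Set.Icc (0 : ℝ) 1 := by
  induction t with
  | output b' => unfold prob; split_ifs <;> simp
  | query x next ih => exact ih _
  | toss q t₁ t₂ ih₁ ih₂ =>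
    exact (convex_Icc (0 : ℝ) 1) ih₁ ih₂ q.2.1 (sub_nonneg.2 q.2.2) (add_sub_cancel _ _)

section Learning

variable {n m : ℕ}

open Classical in
/-- The classical simulation. The answers received so far are those of `K` on `S`. As long as some
point outside `S` has average weight at least `τ` over the oracles consistent with these answers,
such a point is queried, up to `N` times; then the output is `true` with the average of `p` over
the consistent oracles as its probability. -/
noncomputable def learnHeavy (W : Bits n → Oracle n m → ℝ) (p : Oracle n m → ℝ) (τ : ℝ) :
    ℕ → Finset (Bits n) → Oracle n m → ClassicalTree n m Bool
  | 0, S, K => .toss (Set.projIcc 0 1 zero_le_one (cubeAvg S K p)) (.output true) (.output false)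
  | N + 1, S, K =>
    if h : ∃ x ∉ S, τ ≤ cubeAvg S K (W x) then
      .query h.choose fun y => learnHeavy W p τ N (insert h.choose S) (Function.update K h.choose y)
    else
      .toss (Set.projIcc 0 1 zero_le_one (cubeAvg S K p)) (.output true) (.output false)

variable {W : Bits n → Oracle n m → ℝ} {p : Oracle n m → ℝ} {τ Q : ℝ}

lemma queries_learnHeavy_le (N : ℕ) (S : Finset (Bits n)) (K : Oracle n m) :
    (learnHeavy W p τ N S K).queries ≤ N := by
  induction N generalizing S K with
  | zero => simp [learnHeavy, ClassicalTree.queries]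
  | succ N ih =>
    rw [learnHeavy]
    split_ifs with h
    · rw [ClassicalTree.queries, add_comm]
      exact Nat.add_le_add_right (Finset.sup_le fun y _ => ih _ _) 1
    · simp [ClassicalTree.queries]

/-- The simulation depends only on the answers received so far. -/
lemma learnHeavy_congr (N : ℕ) {S : Finset (Bits n)} {K K' : Oracle n m}
    (h : ∀ x ∈ S, K x = K' x) : learnHeavy W p τ N S K = learnHeavy W p τ N S K' := by
  have hc : ∀ {S : Finset (Bits n)} {K K' : Oracle n m}, (∀ x ∈ S, K x = K' x) →
      cubeAvg S K = cubeAvg S K' := fun h => funext fun f =>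
    Finset.expect_congr rfl fun H _ =>
      congrArg f (Finset.piecewise_congr _ h fun _ _ => rfl)
  induction N generalizing S K K' with
  | zero => simp only [learnHeavy, hc h]
  | succ N ih =>
    simp only [learnHeavy, hc h]
    split_ifs with hx
    · congr 1
      funext y
      refine ih fun z hz => ?_
      by_cases hzx : z = hx.choose
      · simp [hzx]
      · simp only [Function.update_of_ne hzx]
        exact h z ((Finset.mem_insert.1 hz).resolve_left hzx)
    · rfl

lemma prob_toss_projIcc (hW : QueryBounded Q W p) (S : Finset (Bits n)) (K H : Oracle n m) :
    ClassicalTree.prob H true (.toss (Set.projIcc 0 1 zero_le_one (cubeAvg S K p))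
      (.output true) (.output false)) = cubeAvg S K p := by
  have h0 : 0 ≤ cubeAvg S K p := cubeAvg_nonneg hW.nonneg
  have h1 : cubeAvg S K p ≤ 1 :=
    (cubeAvg_mono fun H _ => hW.le_one H).trans (cubeAvg_const S K 1).le
  simp [ClassicalTree.prob, Set.projIcc_of_mem zero_le_one (⟨h0, h1⟩ : _ ∈ Set.Icc (0 : ℝ) 1)]

lemma cubeAvg_prob_query {S : Finset (Bits n)} {K : Oracle n m} {x : Bits n}
    (hx : x ∈ S) (t : Bits m → ClassicalTree n m Bool) :
    cubeAvg S K (fun H => (ClassicalTree.query x t).prob H true) =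
      cubeAvg S K (fun H => (t (K x)).prob H true) :=
  cubeAvg_congr fun H hH => by rw [ClassicalTree.prob, hH x hx]

/-- On a uniform oracle the simulation accepts exactly as often as the simulated algorithm,
whether or not it runs out of queries. -/
lemma cubeAvg_prob_learnHeavy (hW : QueryBounded Q W p) (N : ℕ) (S : Finset (Bits n))
    (K : Oracle n m) :
    cubeAvg S K (fun H => (learnHeavy W p τ N S K).prob H true) = cubeAvg S K p := by
  induction N generalizing S K with
  | zero => simp only [learnHeavy, prob_toss_projIcc hW, cubeAvg_const]
  | succ N ih =>
    rw [learnHeavy]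
    split_ifs with h
    · have hx := h.choose_spec.1
      rw [cubeAvg_insert hx, cubeAvg_insert hx K p]
      refine Finset.expect_congr rfl fun H _ => ?_
      rw [cubeAvg_prob_query (Finset.mem_insert_self _ _), Function.update_self, ih]
    · simp only [prob_toss_projIcc hW, cubeAvg_const]

/-- The simulation also does well on the subcubes with few further fixed points `C`. While
no point of `C` is queried, the answers are as for a uniform oracle, so that every query is expected
to use up `τ` of the remaining query weight, which is at most `Q`; each of the at most `C.card`
queries in `C` can only start this count anew. The numerator of the last term bounds the expected
total number of queries, `N₀ - N` of which have been made; by Markov's inequality the quotient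
bounds the probability of running out of queries, and the first term is the error otherwise. -/
lemma abs_cubeAvg_union_learnHeavy_sub_le (hW : QueryBounded Q W p) (hτ : 0 < τ) {N₀ : ℕ}
    (hN₀ : 0 < N₀) (C : Finset (Bits n)) {N : ℕ} (hN : N ≤ N₀) (S : Finset (Bits n))
    (K : Oracle n m) :
    |cubeAvg (S ∪ C) K (fun H => (learnHeavy W p τ N S K).prob H true) - cubeAvg (S ∪ C) K p| ≤
      4 * √(Q * C.card * τ) + ((N₀ - N) + (C \ S).card * (1 + Q / τ) +
        cubeAvg S K (fun H => ∑ x ∈ Sᶜ, W x H) / τ) / N₀ := by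
  have hQ := hW.bound_nonneg
  have hN₀' : (0 : ℝ) < N₀ := by exact_mod_cast hN₀
  have hφ : ∀ S K, 0 ≤ cubeAvg S K (fun H => ∑ x ∈ Sᶜ, W x H) := fun S K =>
    cubeAvg_nonneg fun H => Finset.sum_nonneg fun x _ => hW.weight_nonneg x H
  have hrest : ∀ S K, 0 ≤ (C \ S).card * (1 + Q / τ) +
      cubeAvg S K (fun H => ∑ x ∈ Sᶜ, W x H) / τ := fun S K =>
    add_nonneg (by positivity) (div_nonneg (hφ S K) hτ.le)
  induction N generalizing S K with
  | zero =>
    have h1 : |cubeAvg (S ∪ C) K (fun H => (learnHeavy W p τ 0 S K).prob H true) -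
        cubeAvg (S ∪ C) K p| ≤ 1 := by
      rw [← cubeAvg_sub]
      refine (abs_cubeAvg_le _ _ _).trans ((cubeAvg_mono fun H _ => ?_).trans
        (cubeAvg_const (S ∪ C) K 1).le)
      obtain ⟨a, b⟩ := ClassicalTree.prob_mem_Icc H true (learnHeavy W p τ 0 S K)
      have c := hW.nonneg H
      have d := hW.le_one H
      exact abs_le.2 ⟨by linarith, by linarith⟩
    have h2 : (1 : ℝ) ≤ ((N₀ - (0 : ℕ)) + (C \ S).card * (1 + Q / τ) +
        cubeAvg S K (fun H => ∑ x ∈ Sᶜ, W x H) / τ) / N₀ := by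
      rw [le_div_iff₀ hN₀']
      have := hrest S K
      push_cast
      linarith
    have h3 : 0 ≤ 4 * √(Q * C.card * τ) := by positivity
    linarith
  | succ N ih =>
    rw [learnHeavy]
    split_ifs with h
    · obtain ⟨hx, hheavy⟩ := h.choose_spec
      generalize h.choose = x at hx hheavy
      specialize ih (by omega)
      by_cases hxC : x ∈ C
      · have e : S ∪ C = insert x S ∪ C := by
          ext z; simp only [Finset.mem_union, Finset.mem_insert]; aesop
        rw [cubeAvg_prob_query (Finset.mem_union_right _ hxC), e]
        have hK : Function.update K x (K x) = K := Function.update_eq_self x K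
        rw [hK]
        refine (ih (insert x S) K).trans ?_
        refine add_le_add le_rfl (div_le_div_of_nonneg_right ?_ hN₀'.le)
        have hcard : ((C \ insert x S).card : ℝ) + 1 = (C \ S).card := by
          have hxCS : x ∈ C \ S := Finset.mem_sdiff.2 ⟨hxC, hx⟩
          rw [← Finset.card_erase_add_one hxCS, ← Finset.sdiff_insert, Nat.cast_add_one]
        have hφQ : cubeAvg (insert x S) K (fun H => ∑ x ∈ (insert x S)ᶜ, W x H) / τ ≤ Q / τ := by
          gcongr
          exact (cubeAvg_mono fun H _ => hW.sum_le _ H).trans (cubeAvg_const _ K Q).le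
        have := div_nonneg (hφ S K) hτ.le
        rw [← hcard]
        push_cast
        linarith
      · have hxSC : x ∉ S ∪ C := by simp [hx, hxC]
        have e : insert x (S ∪ C) = insert x S ∪ C := (Finset.insert_union x S C).symm
        rw [cubeAvg_insert hxSC, cubeAvg_insert hxSC K p, ← Finset.expect_sub_distrib, e]
        -- the values of the average weight after the answer average to its value before
        have hdrop : 𝔼 H : Oracle n m, cubeAvg (insert x S) (Function.update K x (H x))
            (fun H => ∑ z ∈ (insert x S)ᶜ, W z H) =
            cubeAvg S K (fun H => ∑ z ∈ Sᶜ, W z H) - cubeAvg S K (W x) := by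
          rw [← cubeAvg_insert hx, ← cubeAvg_sub]
          refine cubeAvg_congr fun H _ => ?_
          rw [eq_sub_iff_add_eq, Finset.compl_insert]
          exact Finset.sum_erase_add _ _ (by simpa using hx)
        have hcard : C \ insert x S = C \ S := by
          rw [Finset.sdiff_insert, Finset.erase_eq_of_notMem]
          simp [hxC]
        calc _ ≤ _ := Finset.abs_expect_le _ _
          _ ≤ 𝔼 H : Oracle n m, (4 * √(Q * C.card * τ) + ((N₀ - N) +
              (C \ S).card * (1 + Q / τ) +
              cubeAvg (insert x S) (Function.update K x (H x))
                (fun H => ∑ z ∈ (insert x S)ᶜ, W z H) / τ) / N₀) := by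
            refine Finset.expect_le_expect fun H _ => ?_
            rw [cubeAvg_prob_query (Finset.mem_union_left _ (Finset.mem_insert_self _ _)),
              Function.update_self, ← hcard]
            exact ih _ _
          _ = 4 * √(Q * C.card * τ) + ((N₀ - N) + (C \ S).card * (1 + Q / τ) +
              (cubeAvg S K (fun H => ∑ z ∈ Sᶜ, W z H) - cubeAvg S K (W x)) / τ) / N₀ := by
            rw [← hdrop]
            simp only [Finset.expect_add_distrib, Fintype.expect_const, ← Finset.expect_div]
          _ ≤ _ := by
            have h1 : 1 ≤ cubeAvg S K (W x) / τ := (one_le_div hτ).2 hheavy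
            refine add_le_add le_rfl (div_le_div_of_nonneg_right ?_ hN₀'.le)
            rw [sub_div]
            push_cast
            linarith
    · push Not at h
      simp only [prob_toss_projIcc hW, cubeAvg_const]
      rw [abs_sub_comm]
      refine (hW.abs_cubeAvg_union_sub_le hτ.le fun x hx => (h x hx).le).trans ?_
      refine le_add_of_nonneg_right (div_nonneg ?_ hN₀'.le)
      have h1 : (0 : ℝ) ≤ N₀ - (N + 1 : ℕ) := sub_nonneg.2 (by exact_mod_cast hN)
      have := hrest S K
      linarith

end Learning

/-! ### Block sensitivity and certificates -/

section Certificates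

variable {ι κ β : Type*}

/-- The value of `y` at `H` can be changed by changing `H` on `B` only. -/
def IsSensitiveBlock (y : (ι → κ) → β) (H : ι → κ) (B : Finset ι) : Prop :=
  ∃ H', (∀ x ∉ B, H' x = H x) ∧ y H' ≠ y H

/-- The block sensitivity of `y` is at most `b`. -/
def BlockSensitivityLE (y : (ι → κ) → β) (b : ℕ) : Prop :=
  ∀ (H : ι → κ) (𝓑 : Finset (Finset ι)), (𝓑 : Set (Finset ι)).PairwiseDisjoint id →
    (∀ B ∈ 𝓑, IsSensitiveBlock y H B) → 𝓑.card ≤ b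

/-- The values of `H` on `S` determine the value of `y`. -/
def IsCertificate (y : (ι → κ) → β) (H : ι → κ) (S : Finset ι) : Prop :=
  ∀ H', (∀ x ∈ S, H' x = H x) → y H' = y H

variable {y : (ι → κ) → β} {b : ℕ}

lemma IsSensitiveBlock.nonempty {H : ι → κ} {B : Finset ι} (h : IsSensitiveBlock y H B) :
    B.Nonempty := by
  obtain ⟨H', h1, h2⟩ := h
  rw [Finset.nonempty_iff_ne_empty]
  rintro rfl
  exact h2 (congrArg y (funext fun x => h1 x (Finset.notMem_empty x)))

/-- Flipping a minimal sensitive block `B` makes every single point of `B` sensitive, whatever the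
size of the alphabet. -/
lemma BlockSensitivityLE.card_le_of_minimal [DecidableEq ι] (hb : BlockSensitivityLE y b)
    {H : ι → κ} {B : Finset ι} (hB : Minimal (IsSensitiveBlock y H) B) : B.card ≤ b := by
  obtain ⟨H', h1, h2⟩ := hB.prop
  have key : ∀ x ∈ B, IsSensitiveBlock y H' {x} := by
    intro x hx
    refine ⟨Function.update H' x (H x), fun z hz => by simp_all, fun h => ?_⟩
    have hs : IsSensitiveBlock y H (B.erase x) := by
      refine ⟨Function.update H' x (H x), fun z hz => ?_, h ▸ h2⟩
      by_cases hzx : z = x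
      · simp [hzx]
      · simp only [Function.update_of_ne hzx]
        exact h1 z fun hzB => hz (Finset.mem_erase.2 ⟨hzx, hzB⟩)
    exact Finset.notMem_erase x B (hB.le_of_le hs (Finset.erase_subset x B) hx)
  have h := hb H' (B.map ⟨fun x => {x}, Finset.singleton_injective⟩) ?_ ?_
  · simpa using h
  · intro s hs t ht hst
    obtain ⟨u, -, rfl⟩ := Finset.mem_map.1 hs
    obtain ⟨v, -, rfl⟩ := Finset.mem_map.1 ht
    simpa [Function.onFun] using hst
  · intro s hs
    obtain ⟨u, hu, rfl⟩ := Finset.mem_map.1 hs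
    exact key u hu

/-- A maximal family of disjoint minimal sensitive blocks covers a certificate. -/
lemma BlockSensitivityLE.exists_certificate [Fintype ι] [DecidableEq ι]
    (hb : BlockSensitivityLE y b) (H : ι → κ) : ∃ S, IsCertificate y H S ∧ S.card ≤ b * b := by
  classical
  let P : Finset (Finset ι) → Prop := fun 𝓑 =>
    (𝓑 : Set (Finset ι)).PairwiseDisjoint id ∧ ∀ B ∈ 𝓑, Minimal (IsSensitiveBlock y H) B
  obtain ⟨𝓑, h𝓑⟩ := (Set.toFinite {𝓑 | P 𝓑}).exists_maximal ⟨∅, by simp [P]⟩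
  obtain ⟨hdisj, hmin⟩ : P 𝓑 := h𝓑.prop
  refine ⟨𝓑.biUnion id, fun H' hH' => ?_, ?_⟩
  · by_contra hne
    have hs : IsSensitiveBlock y H (Finset.univ.filter fun x => H' x ≠ H x) :=
      ⟨H', fun x hx => by simpa using hx, hne⟩
    obtain ⟨B, hBle, hB⟩ := exists_minimal_le_of_wellFoundedLT _ _ hs
    have hBdisj : ∀ B' ∈ 𝓑, Disjoint B B' := by
      intro B' hB'
      rw [Finset.disjoint_left]
      intro x hx hx'
      have h1 : H' x ≠ H x := (Finset.mem_filter.1 (hBle hx)).2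
      exact h1 (hH' x (Finset.mem_biUnion.2 ⟨B', hB', hx'⟩))
    have hP : P (insert B 𝓑) := by
      refine ⟨?_, ?_⟩
      · rw [Finset.coe_insert]
        exact hdisj.insert fun B' hB' _ => hBdisj B' hB'
      · intro B' hB'
        rcases Finset.mem_insert.1 hB' with rfl | hB'
        · exact hB
        · exact hmin B' hB'
    have hmem : B ∈ 𝓑 := h𝓑.le_of_ge hP (Finset.subset_insert B 𝓑) (Finset.mem_insert_self B 𝓑)
    exact hB.prop.nonempty.ne_empty (disjoint_self.1 (hBdisj B hmem))
  · calc (𝓑.biUnion id).card ≤ 𝓑.card * b :=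
          Finset.card_biUnion_le_card_mul _ _ _ fun B hB => hb.card_le_of_minimal (hmin B hB)
      _ ≤ b * b := Nat.mul_le_mul_right b (hb H 𝓑 hdisj fun B hB => (hmin B hB).prop)

/-! ### Averaging over subcubes on which a function is constant -/

/-- Certificates of oracles with different values conflict; hence they share a point at which
the values are not yet fixed. -/
lemma IsCertificate.exists_mem_inter_notMem [DecidableEq ι] {H₁ H₂ : ι → κ} {C₁ C₂ S : Finset ι}
    (h₁ : IsCertificate y H₁ C₁) (h₂ : IsCertificate y H₂ C₂) (hS : ∀ x ∈ S, H₁ x = H₂ x)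
    (hne : y H₁ ≠ y H₂) : ∃ x ∈ C₁ ∩ C₂, x ∉ S := by
  by_contra! h
  have e₁ := h₁ (C₁.piecewise H₁ H₂) fun x hx => by simp [hx]
  have e₂ := h₂ (C₁.piecewise H₁ H₂) fun x hx => by
    by_cases hx' : x ∈ C₁
    · simp [hx', hS x (h x (Finset.mem_inter.2 ⟨hx', hx⟩))]
    · simp [hx']
  exact hne (e₁.symm.trans e₂)

variable [Fintype ι] [DecidableEq ι] [Fintype κ] [Nonempty κ]

/-- If the averages of `F · v` over all subcubes with few fixed points are small, then so is
the average of `F H (y H)` for a function `y` with small certificates. As for decision trees, one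
fixes the points of the certificates of two oracles with different values, which uses up a point of
every remaining certificate, until `y` is constant. -/
lemma abs_cubeAvg_comp_le {C D : ℕ} {err : ℝ} {cert : (ι → κ) → Finset ι}
    (hcert : ∀ H, IsCertificate y H (cert H)) (hC : ∀ H, (cert H).card ≤ C)
    {F : (ι → κ) → β → ℝ}
    (hF : ∀ (S : Finset ι) (K : ι → κ) (v : β), S.card ≤ D →
      |cubeAvg S K (fun H => F H v)| ≤ err)
    (r : ℕ) (S : Finset ι) (K : ι → κ) (hD : S.card + r * (2 * C) ≤ D)
    (hr : ∀ H, (∀ x ∈ S, H x = K x) → (cert H \ S).card ≤ r) :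
    |cubeAvg S K (fun H => F H (y H))| ≤ err := by
  induction r generalizing S K with
  | zero =>
    have hconst : ∀ H, (∀ x ∈ S, H x = K x) → y H = y K := by
      intro H hH
      have h0 : cert H \ S = ∅ := Finset.card_eq_zero.1 (Nat.le_zero.1 (hr H hH))
      exact (hcert H K fun x hx => (hH x (Finset.sdiff_eq_empty_iff_subset.1 h0 hx)).symm).symm
    rw [cubeAvg_congr fun H hH => by rw [hconst H hH]]
    exact hF S K (y K) (by omega)
  | succ r ih =>
    by_cases hconst : ∀ H, (∀ x ∈ S, H x = K x) → y H = y K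
    · rw [cubeAvg_congr fun H hH => by rw [hconst H hH]]
      exact hF S K (y K) (by omega)
    · push Not at hconst
      obtain ⟨H₁, hH₁, hne⟩ := hconst
      set S' := S ∪ (cert K ∪ cert H₁) with hS'
      have hsub : S ⊆ S' := Finset.subset_union_left
      have hcard : S'.card ≤ S.card + 2 * C := by
        have h1 : S'.card ≤ _ := Finset.card_union_le S (cert K ∪ cert H₁)
        have h2 := Finset.card_union_le (cert K) (cert H₁)
        have h3 := hC K
        have h4 := hC H₁
        omega
      rw [cubeAvg_tower hsub]
      refine (abs_cubeAvg_le _ _ _).trans ((cubeAvg_mono fun K' hK' => ?_).trans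
        (cubeAvg_const S K err).le)
      refine ih S' K' (by rw [add_mul] at hD; omega) fun H hH => ?_
      have hHK : ∀ x ∈ S, H x = K x := fun x hx => (hH x (hsub hx)).trans (hK' x hx)
      obtain ⟨x, hx, hxS, hxS'⟩ : ∃ x ∈ cert H, x ∉ S ∧ x ∈ S' := by
        by_cases hv : y H = y K
        · obtain ⟨x, hx, hxS⟩ := (hcert H).exists_mem_inter_notMem (hcert H₁) (S := S)
            (fun x hx => (hHK x hx).trans (hH₁ x hx).symm) (hv.trans_ne hne.symm)
          rw [Finset.mem_inter] at hx
          exact ⟨x, hx.1, hxS, by simp [hS', hx.2]⟩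
        · obtain ⟨x, hx, hxS⟩ := (hcert H).exists_mem_inter_notMem (hcert K) (S := S) hHK hv
          rw [Finset.mem_inter] at hx
          exact ⟨x, hx.1, hxS, by simp [hS', hx.2]⟩
      have hlt : (cert H \ S').card < (cert H \ S).card :=
        Finset.card_lt_card (Finset.ssubset_iff_subset_ne.2
          ⟨Finset.sdiff_subset_sdiff le_rfl hsub, fun h => by
            have : x ∈ cert H \ S' := h ▸ Finset.mem_sdiff.2 ⟨hx, hxS⟩
            exact (Finset.mem_sdiff.1 this).2 hxS'⟩)
      have := hr H hHK
      omega

/-- A function of block sensitivity at most `b` is constant on the parts of a partition into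
subcubes with at most `2 * b ^ 4` fixed points, so averages over such subcubes control it. -/
lemma BlockSensitivityLE.abs_expect_comp_le (hb : BlockSensitivityLE y b) {err : ℝ}
    {F : (ι → κ) → β → ℝ}
    (hF : ∀ (S : Finset ι) (K : ι → κ) (v : β), S.card ≤ 2 * b ^ 4 →
      |cubeAvg S K (fun H => F H v)| ≤ err) :
    |𝔼 H, F H (y H)| ≤ err := by
  choose cert hcert hC using hb.exists_certificate
  rw [← cubeAvg_empty (fun _ => Classical.arbitrary κ)]
  refine abs_cubeAvg_comp_le hcert hC hF (b * b) ∅ _ ?_ fun H _ => ?_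
  · rw [Finset.card_empty]
    exact le_of_eq (by ring)
  · simpa using hC H

end Certificates

/-! ### Nearly deterministic quantum algorithms -/

namespace QuantumAlg

variable {n m Q : ℕ} {α β : Type} [DecidableEq β]

lemma queryBounded_prob (A : QuantumAlg n m Q α β) (a : α) (b : β) :
    QueryBounded (Q : ℝ) (A.queryWeight a) (fun H => A.prob H a b) where
  weight_nonneg := A.queryWeight_nonneg a
  sum_weight_le H := (A.sum_univ_queryWeight a H).le
  nonneg H := A.prob_nonneg H a b
  le_one H := A.prob_le_one H a b
  sq_sub_le _ _ _ h := A.sq_prob_sub_le a b h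

/-- Each of the disjoint sensitive blocks needs query weight `(1 - 2 * δ) ^ 2 / (16 * Q)`, and there
is query weight `Q` in total. -/
lemma blockSensitivityLE [Fintype β] (A : QuantumAlg n m Q α β) {δ : ℝ} (hδ : δ < 1 / 2) (a : α)
    {y : Oracle n m → β}
    (hy : ∀ H, ∑ b ∈ Finset.univ.filter (· ≠ y H), A.prob H a b ≤ δ) :
    BlockSensitivityLE y ⌊16 * (Q : ℝ) ^ 2 * (1 - 2 * δ)⁻¹ ^ 2⌋₊ := by
  intro H 𝓑 hdisj hsens
  have hδ' : 0 < 1 - 2 * δ := by linarith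
  have hother : ∀ H b, b ≠ y H → A.prob H a b ≤ δ := fun H b hb =>
    (Finset.single_le_sum (f := fun b => A.prob H a b) (fun b _ => A.prob_nonneg H a b)
      (Finset.mem_filter.2 ⟨Finset.mem_univ b, hb⟩)).trans (hy H)
  have hself : 1 - δ ≤ A.prob H a (y H) := by
    have h1 := A.sum_prob H a
    rw [← Finset.add_sum_erase _ _ (Finset.mem_univ (y H)), ← Finset.filter_ne'] at h1
    linarith [hy H]
  have hblock : ∀ B ∈ 𝓑, (1 - 2 * δ) ^ 2 ≤ 16 * Q * ∑ x ∈ B, A.queryWeight a x H := by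
    intro B hB
    obtain ⟨H', h1, h2⟩ := hsens B hB
    refine le_trans ?_ (A.sq_prob_sub_le a (y H) (H₂ := H') fun x hx => (h1 x hx).symm)
    have := hother H' (y H) h2.symm
    exact pow_le_pow_left₀ hδ'.le (by linarith) 2
  have htotal : (𝓑.card : ℝ) * (1 - 2 * δ) ^ 2 ≤ 16 * Q * Q := by
    calc (𝓑.card : ℝ) * (1 - 2 * δ) ^ 2
        ≤ ∑ B ∈ 𝓑, 16 * Q * ∑ x ∈ B, A.queryWeight a x H := by
          rw [← nsmul_eq_mul]
          exact Finset.card_nsmul_le_sum _ _ _ hblock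
      _ = 16 * Q * ∑ x ∈ 𝓑.biUnion id, A.queryWeight a x H := by
          rw [← Finset.mul_sum, Finset.sum_biUnion hdisj]
          rfl
      _ ≤ 16 * Q * Q := by
          gcongr
          exact (A.queryBounded_prob a (y H)).sum_le _ H
  refine Nat.le_floor ?_
  rw [inv_pow, ← div_eq_mul_inv, le_div_iff₀ (by positivity)]
  linarith

end QuantumAlg

/-! ### The classical distinguisher -/

/-- A quantum acceptance probability can be simulated classically so that the average over all
oracles is exact and the averages over subcubes with few fixed points are approximate. -/
lemma exists_classicalTree_of_queryBounded {n m : ℕ} {W : Bits n → Oracle n m → ℝ}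
    {p : Oracle n m → ℝ} {Q τ : ℝ} (hW : QueryBounded Q W p) (hτ : 0 < τ) {N : ℕ} (hN : 0 < N) :
    ∃ T : ClassicalTree n m Bool, T.queries ≤ N ∧ 𝔼 H, T.prob H true = 𝔼 H, p H ∧
      ∀ (S : Finset (Bits n)) (K : Oracle n m),
        |cubeAvg S K (fun H => p H - T.prob H true)| ≤
          4 * √(Q * S.card * τ) + (S.card * (1 + Q / τ) + Q / τ) / N := by
  have hN' : (0 : ℝ) < N := by exact_mod_cast hN
  refine ⟨learnHeavy W p τ N ∅ (fun _ _ => false), queries_learnHeavy_le _ _ _, ?_,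
    fun S K => ?_⟩
  · rw [← cubeAvg_empty (fun _ _ => false), cubeAvg_prob_learnHeavy hW, cubeAvg_empty]
  · have h := abs_cubeAvg_union_learnHeavy_sub_le hW hτ hN S le_rfl ∅ K
    rw [learnHeavy_congr N (K' := fun _ _ => false) (by simp), Finset.empty_union,
      Finset.sdiff_empty, sub_self, zero_add] at h
    rw [cubeAvg_sub, abs_sub_comm]
    refine h.trans (add_le_add le_rfl (div_le_div_of_nonneg_right ?_ hN'.le))
    gcongr
    exact (cubeAvg_mono fun H _ => hW.sum_le _ H).trans (cubeAvg_const _ K Q).le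

/-- The choice of the threshold `τ` and the number `N` of queries that makes both error terms of
the simulation at most `ε / 8`. -/
lemma simulation_error_le {Q D ε s N τ : ℝ} (hQ : 0 ≤ Q) (hε : 0 < ε) (hs : 0 ≤ s) (hsD : s ≤ D)
    (hτ : τ = (1024 * (Q * D + 1) * ε⁻¹ ^ 2)⁻¹) (hN : 0 < N)
    (hN' : 8 * ε⁻¹ * (D + (D + 1) * Q * (1024 * (Q * D + 1) * ε⁻¹ ^ 2)) ≤ N) :
    4 * √(Q * s * τ) + (s * (1 + Q / τ) + Q / τ) / N ≤ ε / 4 := by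
  have hD : 0 ≤ D := hs.trans hsD
  have hQD : 0 < Q * D + 1 := by positivity
  have h1 : √(Q * s * τ) ≤ ε / 32 := by
    rw [Real.sqrt_le_left (by positivity), hτ, ← div_eq_mul_inv, div_le_iff₀ (by positivity)]
    have : (ε / 32) ^ 2 * (1024 * (Q * D + 1) * ε⁻¹ ^ 2) = Q * D + 1 := by
      field_simp
      norm_num
    rw [this]
    have := mul_le_mul_of_nonneg_left hsD hQ
    linarith
  have h2 : (s * (1 + Q / τ) + Q / τ) / N ≤ ε / 8 := by
    rw [div_le_iff₀ hN]
    have hτ' : Q / τ = Q * (1024 * (Q * D + 1) * ε⁻¹ ^ 2) := by rw [hτ, div_inv_eq_mul]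
    have hQτ : 0 ≤ Q / τ := by rw [hτ']; positivity
    calc s * (1 + Q / τ) + Q / τ ≤ D * (1 + Q / τ) + Q / τ := by gcongr
      _ = ε / 8 * (8 * ε⁻¹ * (D + (D + 1) * Q * (1024 * (Q * D + 1) * ε⁻¹ ^ 2))) := by
        rw [hτ']
        field_simp
        ring
      _ ≤ ε / 8 * N := by gcongr
  linarith

/-- The loss from replacing a nearly deterministic output by its most likely value `y H`. The
probability of this value lies in `[1 - δ, 1]`; comparing with the centre `1 - δ / 2` of this
interval bounds the loss by `3 * δ / 2` rather than `2 * δ`. -/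
lemma abs_expect_sum_mul_le {Ω β : Type*} [Fintype Ω] [Nonempty Ω] [Fintype β] [DecidableEq β]
    {pr F : Ω → β → ℝ} {y : Ω → β} {δ err : ℝ} (hδ : δ < 1 / 2) (hpr : ∀ H b, 0 ≤ pr H b)
    (hsum : ∀ H, ∑ b, pr H b = 1)
    (hy : ∀ H, ∑ b ∈ Finset.univ.filter (· ≠ y H), pr H b ≤ δ) (hF : ∀ H b, |F H b| ≤ 1)
    (herr : |𝔼 H, F H (y H)| ≤ err) :
    |𝔼 H, ∑ b, pr H b * F H b| ≤ err + 3 * δ / 2 := by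
  have hδ0 : 0 ≤ δ := (Finset.sum_nonneg fun b _ => hpr (Classical.arbitrary Ω) b).trans (hy _)
  have hpt : ∀ H, |∑ b, pr H b * F H b - (1 - δ / 2) * F H (y H)| ≤ 3 * δ / 2 := by
    intro H
    set θ := ∑ b ∈ Finset.univ.filter (· ≠ y H), pr H b with hθ
    set R := ∑ b ∈ Finset.univ.filter (· ≠ y H), pr H b * F H b with hR
    have hθ0 : 0 ≤ θ := Finset.sum_nonneg fun b _ => hpr H b
    have hself : pr H (y H) = 1 - θ := by
      have h1 := hsum H
      rw [← Finset.add_sum_erase _ _ (Finset.mem_univ (y H)), ← Finset.filter_ne'] at h1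
      linarith
    have hsplit : ∑ b, pr H b * F H b = (1 - θ) * F H (y H) + R := by
      rw [← Finset.add_sum_erase _ _ (Finset.mem_univ (y H)), ← Finset.filter_ne', hself]
    have hRθ : |R| ≤ θ := by
      refine (Finset.abs_sum_le_sum_abs _ _).trans (Finset.sum_le_sum fun b _ => ?_)
      rw [abs_mul, abs_of_nonneg (hpr H b)]
      exact mul_le_of_le_one_right (hpr H b) (hF H b)
    have hmid : |(δ / 2 - θ) * F H (y H)| ≤ δ / 2 := by
      rw [abs_mul]
      have h1 : |δ / 2 - θ| ≤ δ / 2 := abs_le.2 ⟨by linarith [hy H], by linarith⟩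
      exact (mul_le_of_le_one_right (abs_nonneg _) (hF H _)).trans h1
    have e : ∑ b, pr H b * F H b - (1 - δ / 2) * F H (y H) = R + (δ / 2 - θ) * F H (y H) := by
      rw [hsplit]
      ring
    rw [e]
    linarith [abs_add_le R ((δ / 2 - θ) * F H (y H)), hy H]
  have hsplit : 𝔼 H, ∑ b, pr H b * F H b =
      𝔼 H, (∑ b, pr H b * F H b - (1 - δ / 2) * F H (y H)) + (1 - δ / 2) * 𝔼 H, F H (y H) := by
    rw [Finset.expect_sub_distrib, ← Finset.mul_expect]
    ring
  have h1 : |𝔼 H, (∑ b, pr H b * F H b - (1 - δ / 2) * F H (y H))| ≤ 3 * δ / 2 :=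
    (Finset.abs_expect_le _ _).trans
      (Finset.expect_le Finset.univ_nonempty fun H _ => hpt H)
  have h2 : |(1 - δ / 2) * 𝔼 H, F H (y H)| ≤ err := by
    rw [abs_mul, abs_of_nonneg (by linarith)]
    exact (mul_le_of_le_one_left (abs_nonneg _) (by linarith)).trans herr
  rw [hsplit]
  linarith [abs_add_le (𝔼 H, (∑ b, pr H b * F H b - (1 - δ / 2) * F H (y H)))
    ((1 - δ / 2) * 𝔼 H, F H (y H))]

/-- The bound on the number of queries of the classical distinguisher. The variables stand for
`k`, `n`, `QA`, `QG`, `ε⁻¹` and `(1 - 2 * δ)⁻¹`; the first two do not occur. -/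
noncomputable def queryPolynomial : MvPolynomial (Fin 6) ℕ :=
  let D := 2 * (16 * .X 3 ^ 2 * .X 5 ^ 2) ^ 4
  8 * .X 4 * (D + (D + 1) * .X 2 * (1024 * (.X 2 * D + 1) * .X 4 ^ 2)) + 1

theorem mainTheorem3 :
    ∃ P : MvPolynomial (Fin 6) ℕ,
      ∀ (n m k l QG QA : ℕ) (δ ε : ℝ)
        (G : QuantumAlg n m QG (Bits k) (Bits l)) (A : QuantumAlg n m QA (Bits l) Bool),
        δ < 1 / 2 → G.IsDeterministic δ →
        ε = quantumAdvantage A G → 0 < ε →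
        ∃ B : ClassicalAlg n m (Bits l) Bool,
          (∀ g : Bits l, ((B g).queries : ℝ) ≤
            MvPolynomial.aeval ![(k : ℝ), (n : ℝ), (QA : ℝ), (QG : ℝ), ε⁻¹, (1 - 2 * δ)⁻¹] P) ∧
          ε / 2 - δ ≤ classicalAdvantage B G := by
  refine ⟨queryPolynomial, fun n m k l QG QA δ ε G A hδ hG hε hε0 => ?_⟩
  set D : ℝ := 2 * (16 * (QG : ℝ) ^ 2 * (1 - 2 * δ)⁻¹ ^ 2) ^ 4 with hD
  set M : ℝ := 8 * ε⁻¹ * (D + (D + 1) * QA * (1024 * (QA * D + 1) * ε⁻¹ ^ 2)) with hM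
  set τ : ℝ := (1024 * ((QA : ℝ) * D + 1) * ε⁻¹ ^ 2)⁻¹ with hτ
  have hP : MvPolynomial.aeval ![(k : ℝ), (n : ℝ), (QA : ℝ), (QG : ℝ), ε⁻¹, (1 - 2 * δ)⁻¹]
      queryPolynomial = M + 1 := by
    simp [queryPolynomial, hM, hD]
  have hD0 : 0 ≤ D := by positivity
  have hM0 : 0 ≤ M := by positivity
  have hτ0 : 0 < τ := by positivity
  have hN : 0 < ⌊M + 1⌋₊ := Nat.floor_pos.2 (by linarith)
  have hMN : M ≤ ⌊M + 1⌋₊ := by linarith [Nat.lt_floor_add_one (M + 1)]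
  choose B hBq hBE hBcube using fun g : Bits l =>
    exists_classicalTree_of_queryBounded (A.queryBounded_prob g true) hτ0 hN
  refine ⟨B, fun g => ?_, ?_⟩
  · rw [hP]
    exact (Nat.cast_le.2 (hBq g)).trans (Nat.floor_le (by linarith))
  -- the distinguishers differ by little on outputs of the generator, for every seed
  have hseed : ∀ s : Bits k, |𝔼 H : Oracle n m, ∑ g : Bits l,
      G.prob H s g * (A.prob H g true - (B g).prob H true)| ≤ ε / 4 + 3 * δ / 2 := by
    intro s
    choose y hy using fun H => hG H s
    refine abs_expect_sum_mul_le hδ (fun H g => G.prob_nonneg H s g) (fun H => G.sum_prob H s) hy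
      (fun H g => ?_) ?_
    · obtain ⟨h1, h2⟩ := ClassicalTree.prob_mem_Icc H true (B g)
      exact abs_le.2 ⟨by linarith [A.prob_nonneg H g true], by linarith [A.prob_le_one H g true]⟩
    · refine (G.blockSensitivityLE hδ s hy).abs_expect_comp_le
        (F := fun H g => A.prob H g true - (B g).prob H true) fun S K g hS => ?_
      refine (hBcube g S K).trans (simulation_error_le (Nat.cast_nonneg QA) hε0
        (Nat.cast_nonneg _) ?_ hτ (by exact_mod_cast hN) hMN)
      calc (S.card : ℝ) ≤ 2 * (⌊16 * (QG : ℝ) ^ 2 * (1 - 2 * δ)⁻¹ ^ 2⌋₊ : ℝ) ^ 4 := by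
            exact_mod_cast hS
        _ ≤ D := by
            rw [hD]
            gcongr
            exact Nat.floor_le (by positivity)
  -- and agree on average on uniform inputs
  have hunif : (𝔼 H : Oracle n m, 𝔼 g : Bits l, (B g).prob H true) =
      𝔼 H : Oracle n m, 𝔼 g : Bits l, A.prob H g true := by
    rw [Finset.expect_comm, Finset.expect_comm Finset.univ Finset.univ fun H g => A.prob H g true]
    exact Finset.expect_congr rfl fun g _ => hBE g
  have hdiff : |(𝔼 H : Oracle n m, 𝔼 s : Bits k, ∑ g : Bits l, G.prob H s g * A.prob H g true) -
      𝔼 H : Oracle n m, 𝔼 s : Bits k, ∑ g : Bits l, G.prob H s g * (B g).prob H true| ≤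
      ε / 4 + 3 * δ / 2 := by
    simp only [← Finset.expect_sub_distrib, ← Finset.sum_sub_distrib, ← mul_sub]
    rw [Finset.expect_comm]
    exact (Finset.abs_expect_le _ _).trans
      (Finset.expect_le Finset.univ_nonempty fun s _ => hseed s)
  have hadv : ε ≤ ε / 4 + 3 * δ / 2 + classicalAdvantage B G := by
    conv_lhs => rw [hε]
    unfold quantumAdvantage classicalAdvantage prgAdvantage
    rw [hunif]
    exact (abs_sub_le _ _ _).trans (add_le_add hdiff le_rfl)
  have hnonneg : 0 ≤ classicalAdvantage B G := abs_nonneg _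
  rcases le_total (ε / 2) δ with h | h <;> linarith
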